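/- Consider weighted automata over the tropical semiring $(\mathbb{Z}\cup\{\infty\},\min,+)$. Such an automaton $\mathcal{W}$ consists of a nondeterministic finite automaton $(Q,A,\delta,q_0,F)$ with $\delta\subseteq Q\times(A\cup\{\varepsilon\})\times Q$, an initial weight $\lambda\in\mathbb{Z}\cup\{\infty\}$, transition weights $\mu\colon\delta\to\mathbb{Z}\cup\{\infty\}$ and final weights $\nu\colon F\to\mathbb{Z}\cup\{\infty\}$. An accepting run $t_1t_2\cdots t_n\in\delta^*$, leading from $q_0$ to a state $q\in F$, has weight $\lambda+\mu(t_1)+\cdots+\mu(t_n)+\nu(q)$, and the weight $\mathcal{W}(w)$ of a word $w\in A^*$ is the minimum of the weights of the accepting runs labelled by $w$, with $\min\emptyset=\infty$. (Only automata for which this minimum exists for every $w\in A^*$ are considered; it can fail to exist only in the presence of a cycle of $\varepsilon$-transitions of negative total weight.) **Theorem (Upperboundedness).** The following problem is undecidable. Given: a weighted automaton $\mathcal{W}$ over $(\mathbb{Z}\cup\{\infty\},\min,+)$ with finite alphabet $A$. Question: is there a constant $c\in\mathbb{Z}$ such that $\mathcal{W}(w)\le c$ for all $w\in A^*$? That is,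 there is no algorithm which, given a finite description of any such automaton $\mathcal{W}$, correctly answers this question. -/

import Mathlib

/-- A weighted automaton over the tropical semiring `(ℤ ∪ {∞}, min, +)` with alphabet `A` and state
set `Q`: an NFA `(Q, A, δ, q₀, F)` (a transition labelled `none` reads the empty word), an initial
weight `lam`, transition weights `mu` and final weights `nu`.  The element `∞` is `⊤`. -/
structure WeightedAutomaton (A Q : Type) where
  δ : Set (Q × Option A × Q)
  q₀ : Q
  F : Set Q
  lam : WithTop ℤ
  mu : δ → WithTop ℤ
  nu : F → WithTop ℤ

namespace WeightedAutomaton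

variable {A Q : Type} (W : WeightedAutomaton A Q)

/-- `W.IsPath p ts q`: the transitions `ts` are consecutive and lead from `p` to `q`. -/
def IsPath (p : Q) : List W.δ → Q → Prop
  | [], q => p = q
  | t :: ts, q => t.1.1 = p ∧ IsPath t.1.2.2 ts q

/-- The word read by a sequence of transitions. -/
def label (ts : List W.δ) : List A := ts.filterMap fun t => t.1.2.1

/-- The set of weights of the accepting runs of `W` labelled by `w`. -/
def runWeights (w : List A) : Set (WithTop ℤ) :=
  {v | ∃ (ts : List W.δ) (q : W.F), W.IsPath W.q₀ ts q ∧ W.label ts = w ∧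
    v = W.lam + (ts.map W.mu).sum + W.nu q}

/-- The weight of every word is well defined: the weights of its accepting runs have a minimum,
where `∞` is added so that `min ∅ = ∞`.  This can fail only if there is a cycle of negative weight
consisting of transitions that read the empty word. -/
def HasMinima : Prop := ∀ w : List A, ∃ v, IsLeast (insert ⊤ (W.runWeights w)) v

open Classical in
/-- The weight `W(w)` of a word: the minimum weight of the accepting runs over `w`, with
`min ∅ = ∞` (see `isLeast_weight`).  The value where there is no minimum is irrelevant. -/
noncomputable def weight (w : List A) : WithTop ℤ :=
  if h : ∃ v, IsLeast (insert ⊤ (W.runWeights w)) v then h.choose else ⊤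

theorem isLeast_weight (hW : W.HasMinima) (w : List A) :
    IsLeast (insert ⊤ (W.runWeights w)) (W.weight w) := by
  rw [weight, dif_pos (hW w)]
  exact (hW w).choose_spec

/-- Some integer bounds the weights of all words from above. -/
def UpperBounded : Prop := ∃ c : ℤ, ∀ w : List A, W.weight w ≤ (c : WithTop ℤ)

end WeightedAutomaton

instance WithTop.primcodableInt : Primcodable (WithTop ℤ) :=
  inferInstanceAs (Primcodable (Option ℤ))

/-- Finite descriptions of weighted automata, as inputs for algorithms: the number of states, the
number of letters, the initial state, the initial weight, the list of all transitions with their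
weights, and the list of all final states with their weights. -/
abbrev WACode : Type :=
  ℕ × ℕ × ℕ × WithTop ℤ × List ((ℕ × Option ℕ × ℕ) × WithTop ℤ) × List (ℕ × WithTop ℤ)

namespace WeightedAutomaton

/-- `d` is a description of `W`, whose states are `0, …, n - 1` and whose letters are
`0, …, m - 1`. -/
def IsDescribedBy {n m : ℕ} (W : WeightedAutomaton (Fin m) (Fin n)) (d : WACode) : Prop :=
  ∃ (T : List ((ℕ × Option ℕ × ℕ) × WithTop ℤ)) (E : List (ℕ × WithTop ℤ)),
    d = (n, m, (W.q₀ : ℕ), W.lam, T, E) ∧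
    {x | x ∈ T} = Set.range (fun t : W.δ =>
      ((((t.1.1 : Fin n) : ℕ), t.1.2.1.map Fin.val, ((t.1.2.2 : Fin n) : ℕ)), W.mu t)) ∧
    {x | x ∈ E} = Set.range (fun q : W.F => (((q : Fin n) : ℕ), W.nu q))

/-- Every weighted automaton has a description. -/
theorem exists_isDescribedBy {n m : ℕ} (W : WeightedAutomaton (Fin m) (Fin n)) :
    ∃ d, W.IsDescribedBy d := by
  obtain ⟨T, hT⟩ := (Set.finite_range (fun t : W.δ =>
    ((((t.1.1 : Fin n) : ℕ), t.1.2.1.map Fin.val, ((t.1.2.2 : Fin n) : ℕ)), W.mu t))).exists_finset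
  obtain ⟨E, hE⟩ := (Set.finite_range (fun q : W.F =>
    (((q : Fin n) : ℕ), W.nu q))).exists_finset
  refine ⟨_, T.toList, E.toList, rfl, ?_, ?_⟩
  · ext x; simpa using hT x
  · ext x; simpa using hE x

/-- A description determines the weighted automaton. -/
theorem IsDescribedBy.eq {n m : ℕ} {W W' : WeightedAutomaton (Fin m) (Fin n)} {d : WACode}
    (h : W.IsDescribedBy d) (h' : W'.IsDescribedBy d) : W = W' := by
  obtain ⟨T, E, rfl, hT, hE⟩ := h
  obtain ⟨T', E', h', hT', hE'⟩ := h'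
  simp only [Prod.mk.injEq, true_and] at h'
  obtain ⟨hq, hl, rfl, rfl⟩ := h'
  rw [hT] at hT'
  rw [hE] at hE'
  obtain ⟨δ, q₀, F, lam, mu, nu⟩ := W
  obtain ⟨δ', q₀', F', lam', mu', nu'⟩ := W'
  simp only at hq hl hT' hE'
  obtain rfl := Fin.ext hq
  subst hl
  have inj : Function.Injective (fun x : Fin n × Option (Fin m) × Fin n =>
      ((x.1 : ℕ), x.2.1.map Fin.val, (x.2.2 : ℕ))) := by
    rintro ⟨p, a, q⟩ ⟨p', a', q'⟩ h
    simp only [Prod.mk.injEq] at h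
    have := Option.map_injective Fin.val_injective h.2.1
    simp [Fin.ext_iff, h.1, h.2.2, this]
  have key : ∀ {δ δ' : Set (Fin n × Option (Fin m) × Fin n)} {mu : δ → WithTop ℤ}
      {mu' : δ' → WithTop ℤ}, Set.range (fun t : δ => ((((t.1.1 : Fin n) : ℕ),
        t.1.2.1.map Fin.val, ((t.1.2.2 : Fin n) : ℕ)), mu t)) ⊆
      Set.range (fun t : δ' => ((((t.1.1 : Fin n) : ℕ),
        t.1.2.1.map Fin.val, ((t.1.2.2 : Fin n) : ℕ)), mu' t)) →
      ∀ t (ht : t ∈ δ), ∃ ht' : t ∈ δ', mu ⟨t, ht⟩ = mu' ⟨t, ht'⟩ := by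
    intro δ δ' mu mu' h t ht
    obtain ⟨⟨t', ht'⟩, e⟩ := h ⟨⟨t, ht⟩, rfl⟩
    have e1 := (Prod.mk.inj e).1
    have e2 := (Prod.mk.inj e).2
    obtain rfl : t' = t := inj e1
    exact ⟨ht', e2.symm⟩
  have key2 : ∀ {F F' : Set (Fin n)} {nu : F → WithTop ℤ} {nu' : F' → WithTop ℤ},
      Set.range (fun q : F => (((q : Fin n) : ℕ), nu q)) ⊆
      Set.range (fun q : F' => (((q : Fin n) : ℕ), nu' q)) →
      ∀ t (ht : t ∈ F), ∃ ht' : t ∈ F', nu ⟨t, ht⟩ = nu' ⟨t, ht'⟩ := by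
    intro F F' nu nu' h t ht
    obtain ⟨⟨t', ht'⟩, e⟩ := h ⟨⟨t, ht⟩, rfl⟩
    have e1 := (Prod.mk.inj e).1
    have e2 := (Prod.mk.inj e).2
    obtain rfl : t' = t := Fin.ext e1
    exact ⟨ht', e2.symm⟩
  obtain rfl : δ = δ' := Set.ext fun t =>
    ⟨fun h => (key hT'.le t h).1, fun h => (key hT'.ge t h).1⟩
  obtain rfl : F = F' := Set.ext fun t =>
    ⟨fun h => (key2 hE'.le t h).1, fun h => (key2 hE'.ge t h).1⟩
  obtain rfl : mu = mu' := funext fun t => (key hT'.le t.1 t.2).2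
  obtain rfl : nu = nu' := funext fun t => (key2 hE'.le t.1 t.2).2
  rfl

end WeightedAutomaton

/-! The halting problem is reduced to upper-boundedness. A Turing machine becomes a `CounterSystem`:
the control state carries the symbol under the head, the half tapes are two numbers, and a step
imposes one linear equation on each. A word over `S ⊕ R` is read as a sequence of purported
computations, each beginning with `M.init`; the value of the register `r` in a configuration is the
number of letters `r` that follow its control state.

The checking automaton looks for one error in each computation. A forbidden change of control state
is reported at cost `0`. For a register, the automaton guesses an equation and a sign `σ` and pays
`1 + σ * defect`: exactly `1` if the equation holds, and at most `0` for one of the two signs if it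
fails. If the machine does not halt, every purported halting computation contains an error, so all
weights are at most `0` (`accepts_of_not_halts`). If it halts, `n` copies of a correct halting
computation cost at least `n` (`exists_word_of_halts`).

To keep the reduction computable, a single code is fixed whose halting on the inputs `2 ^ m - 1` is
undecidable. All the resulting automata share states and transitions; only the weights that check
the initial value of one half tape depend on `m`. -/

namespace WeightedAutomaton

/-! ### Automata given by integer-weighted edges -/

variable {A Q : Type}

/-- The weighted automaton without empty transitions that has the transitions `E`, weighted by `wt`,
and whose initial and final weights are `0`. -/
def ofEdges (E : Q → A → Q → Prop) (wt : Q → A → Q → ℤ) (q₀ : Q) (F : Set Q) :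
    WeightedAutomaton A Q where
  δ := {t | ∃ a, t.2.1 = some a ∧ E t.1 a t.2.2}
  q₀ := q₀
  F := F
  lam := 0
  mu t := ((t.1.2.1.elim 0 fun a => wt t.1.1 a t.1.2.2 : ℤ) : WithTop ℤ)
  nu _ := 0

/-- `Runs E wt p w q k`: some sequence of transitions reads `w` from `p` to `q` with weight `k`. -/
inductive Runs (E : Q → A → Q → Prop) (wt : Q → A → Q → ℤ) : Q → List A → Q → ℤ → Prop
  | nil (p : Q) : Runs E wt p [] p 0
  | cons {p p' q : Q} {a : A} {w : List A} {k : ℤ} :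
      E p a p' → Runs E wt p' w q k → Runs E wt p (a :: w) q (wt p a p' + k)

variable {E : Q → A → Q → Prop} {wt : Q → A → Q → ℤ}

theorem Runs.append {p q r : Q} {u w : List A} {k l : ℤ} (h : Runs E wt p u q k)
    (h' : Runs E wt q w r l) : Runs E wt p (u ++ w) r (k + l) := by
  induction h with
  | nil p => simpa using h'
  | cons e _ ih => rw [add_assoc]; exact .cons e (ih h')

theorem runs_nil_iff {p q : Q} {k : ℤ} : Runs E wt p [] q k ↔ p = q ∧ k = 0 := by
  constructor
  · rintro ⟨⟩; exact ⟨rfl, rfl⟩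
  · rintro ⟨rfl, rfl⟩; exact .nil _

theorem runs_cons_iff {p q : Q} {a : A} {w : List A} {k : ℤ} : Runs E wt p (a :: w) q k ↔
    ∃ p' l, E p a p' ∧ Runs E wt p' w q l ∧ k = wt p a p' + l := by
  constructor
  · rintro ⟨⟩; exact ⟨_, _, ‹_›, ‹_›, rfl⟩
  · rintro ⟨p', l, e, h, rfl⟩; exact .cons e h

theorem runs_append_iff {p q : Q} {u w : List A} {k : ℤ} : Runs E wt p (u ++ w) q k ↔
    ∃ r l m, Runs E wt p u r l ∧ Runs E wt r w q m ∧ k = l + m := by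
  constructor
  · intro h
    induction u generalizing p k with
    | nil => exact ⟨p, 0, k, .nil p, h, by simp⟩
    | cons a u ih =>
      obtain ⟨p', l, e, h', rfl⟩ := runs_cons_iff.1 h
      obtain ⟨r, l, m, h₁, h₂, rfl⟩ := ih h'
      exact ⟨r, _, m, .cons e h₁, h₂, by ring⟩
  · rintro ⟨r, l, m, h, h', rfl⟩; exact h.append h'

/-- Each transition consumes a letter, so a word has finitely many runs; this is why minima exist.
-/
theorem finite_runs [Finite Q] (p : Q) (w : List A) (q : Q) : {k | Runs E wt p w q k}.Finite := by
  induction w generalizing p with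
  | nil => exact (Set.finite_singleton 0).subset fun k h => (runs_nil_iff.1 h).2
  | cons a w ih =>
    refine (Set.finite_iUnion fun p' => (ih p').image (wt p a p' + ·)).subset fun k h => ?_
    obtain ⟨p', l, -, h', rfl⟩ := runs_cons_iff.1 h
    exact Set.mem_iUnion.2 ⟨p', l, h', rfl⟩

theorem exists_isPath_ofEdges_iff {q₀ : Q} {F : Set Q} {p q : Q} {w : List A} {v : WithTop ℤ} :
    (∃ ts, (ofEdges E wt q₀ F).IsPath p ts q ∧ (ofEdges E wt q₀ F).label ts = w ∧
      v = (ts.map (ofEdges E wt q₀ F).mu).sum) ↔ ∃ k : ℤ, Runs E wt p w q k ∧ v = k := by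
  constructor
  · rintro ⟨ts, h, rfl, rfl⟩
    induction ts generalizing p with
    | nil => obtain rfl : p = q := h; exact ⟨0, .nil _, rfl⟩
    | cons t ts ih =>
      obtain ⟨⟨p', o, r⟩, a, ha, e⟩ := t
      obtain ⟨hp, h⟩ := h
      simp only at ha e hp h
      subst ha hp
      obtain ⟨k, hk, hs⟩ := ih h
      refine ⟨_, .cons e hk, ?_⟩
      rw [List.map_cons, List.sum_cons, hs]
      simp [ofEdges]
  · rintro ⟨k, h, rfl⟩
    induction h with
    | nil p => exact ⟨[], rfl, rfl, rfl⟩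
    | @cons p p' q a w k e _ ih =>
      obtain ⟨ts, h, hl, hs⟩ := ih
      refine ⟨⟨(p, some a, p'), a, rfl, e⟩ :: ts, ⟨rfl, h⟩, ?_, ?_⟩
      · rw [← hl]; rfl
      · rw [List.map_cons, List.sum_cons, ← hs]
        simp [ofEdges]

theorem mem_runWeights_ofEdges {q₀ : Q} {F : Set Q} {w : List A} {v : WithTop ℤ} :
    v ∈ (ofEdges E wt q₀ F).runWeights w ↔ ∃ q ∈ F, ∃ k : ℤ, Runs E wt q₀ w q k ∧ v = k := by
  constructor
  · rintro ⟨ts, q, h, hl, hv⟩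
    refine ⟨q, q.2, exists_isPath_ofEdges_iff.1 ⟨ts, h, hl, ?_⟩⟩
    simpa [ofEdges] using hv
  · rintro ⟨q, hq, h⟩
    obtain ⟨ts, h, hl, hv⟩ := (exists_isPath_ofEdges_iff (q₀ := q₀) (F := F)).2 h
    exact ⟨ts, ⟨q, hq⟩, h, hl, by simpa [ofEdges] using hv⟩

theorem hasMinima_ofEdges [Finite Q] (q₀ : Q) (F : Set Q) : (ofEdges E wt q₀ F).HasMinima := by
  intro w
  have hf : (insert ⊤ ((ofEdges E wt q₀ F).runWeights w)).Finite := by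
    refine Set.Finite.insert _ ((Set.finite_iUnion fun q =>
      (finite_runs (E := E) (wt := wt) q₀ w q).image ((↑) : ℤ → WithTop ℤ)).subset ?_)
    intro v hv
    obtain ⟨q, -, k, h, rfl⟩ := mem_runWeights_ofEdges.1 hv
    exact Set.mem_iUnion.2 ⟨q, k, h, rfl⟩
  obtain ⟨v, hv, hm⟩ := Set.exists_min_image _ id hf (Set.insert_nonempty _ _)
  exact ⟨v, hv, fun x hx => hm x hx⟩

theorem upperBounded_ofEdges_iff [Finite Q] {q₀ : Q} {F : Set Q} :
    (ofEdges E wt q₀ F).UpperBounded ↔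
      ∃ c : ℤ, ∀ w, ∃ q ∈ F, ∃ k ≤ c, Runs E wt q₀ w q k := by
  have hW := hasMinima_ofEdges (E := E) (wt := wt) q₀ F
  refine exists_congr fun c => forall_congr' fun w => ?_
  have hl := isLeast_weight _ hW w
  constructor
  · intro h
    rcases hl.1 with h' | h'
    · rw [h'] at h; exact absurd h (by simp)
    · obtain ⟨q, hq, k, hr, hk⟩ := mem_runWeights_ofEdges.1 h'
      rw [hk] at h
      exact ⟨q, hq, k, by exact_mod_cast h, hr⟩
  · rintro ⟨q, hq, k, hk, h⟩
    exact (hl.2 (Or.inr (mem_runWeights_ofEdges.2 ⟨q, hq, k, h, rfl⟩))).trans (by exact_mod_cast hk)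

theorem Runs.map {A' Q' : Type} (f : A → A') (g : Q → Q') {E' : Q' → A' → Q' → Prop}
    {wt' : Q' → A' → Q' → ℤ} (hE : ∀ p a q, E p a q → E' (g p) (f a) (g q))
    (hwt : ∀ p a q, wt' (g p) (f a) (g q) = wt p a q) {p q : Q} {w : List A} {k : ℤ}
    (h : Runs E wt p w q k) : Runs E' wt' (g p) (w.map f) (g q) k := by
  induction h with
  | nil p => exact .nil _
  | cons e _ ih => rw [← hwt]; exact .cons (hE _ _ _ e) ih

/-- An automaton given by edges on arbitrary finite types, carried over to `Fin n` and `Fin m`. -/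
def finEdges {n m : ℕ} (eQ : Q ≃ Fin n) (eA : A ≃ Fin m) (E : Q → A → Q → Prop)
    (wt : Q → A → Q → ℤ) (q₀ : Q) (F : Set Q) : WeightedAutomaton (Fin m) (Fin n) :=
  ofEdges (fun p a q => E (eQ.symm p) (eA.symm a) (eQ.symm q))
    (fun p a q => wt (eQ.symm p) (eA.symm a) (eQ.symm q)) (eQ q₀) (eQ.symm ⁻¹' F)

theorem upperBounded_finEdges_iff {n m : ℕ} (eQ : Q ≃ Fin n) (eA : A ≃ Fin m) {q₀ : Q}
    {F : Set Q} : (finEdges eQ eA E wt q₀ F).UpperBounded ↔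
      ∃ c : ℤ, ∀ w, ∃ q ∈ F, ∃ k ≤ c, Runs E wt q₀ w q k := by
  rw [finEdges, upperBounded_ofEdges_iff]
  refine exists_congr fun c => ⟨fun h w => ?_, fun h w => ?_⟩
  · obtain ⟨q, hq, k, hk, hr⟩ := h (w.map eA)
    refine ⟨eQ.symm q, hq, k, hk, ?_⟩
    have := hr.map (E' := E) (wt' := wt) eA.symm eQ.symm (fun _ _ _ e => e) (fun _ _ _ => rfl)
    simpa using this
  · obtain ⟨q, hq, k, hk, hr⟩ := h (w.map eA.symm)
    refine ⟨eQ q, by simpa using hq, k, hk, ?_⟩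
    have := hr.map (E' := fun p a q => E (eQ.symm p) (eA.symm a) (eQ.symm q))
      (wt' := fun p a q => wt (eQ.symm p) (eA.symm a) (eQ.symm q)) eA eQ
      (fun _ _ _ e => by simpa using e) (fun _ _ _ => by simp)
    simpa using this

/-- The list is fixed, so no uniformity in `a` is needed. -/
theorem computable_list_map_of_forall {α β : Type} [Primcodable β] (f : α → ℕ → β) (l : List α)
    (h : ∀ a, Computable (f a)) : Computable fun n => l.map fun a => f a n := by
  induction l with
  | nil => exact Computable.const []
  | cons a l ih => exact Computable.list_cons.comp (h a) ih

/-- If the weights of the transitions depend computably on a parameter, then so does a description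
of the automaton. -/
theorem exists_computable_description {n m : ℕ} (eQ : Q ≃ Fin n) (eA : A ≃ Fin m)
    (E : Q → A → Q → Prop) (wt : ℕ → Q → A → Q → ℤ)
    (hwt : ∀ p a q, Computable fun i => wt i p a q) (q₀ : Q) (F : Set Q) :
    ∃ d : ℕ → WACode, Computable d ∧
      ∀ i, (finEdges eQ eA E (wt i) q₀ F).IsDescribedBy (d i) := by
  classical
  let l : List (Fin n × Fin m × Fin n) := (Finset.univ.filter fun t : Fin n × Fin m × Fin n =>
    E (eQ.symm t.1) (eA.symm t.2.1) (eQ.symm t.2.2)).toList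
  let f : Fin n × Fin m × Fin n → ℕ → (ℕ × Option ℕ × ℕ) × WithTop ℤ := fun t i =>
    (((t.1 : ℕ), some (t.2.1 : ℕ), (t.2.2 : ℕ)),
      ((wt i (eQ.symm t.1) (eA.symm t.2.1) (eQ.symm t.2.2) : ℤ) : WithTop ℤ))
  let l' : List (ℕ × WithTop ℤ) :=
    (Finset.univ.filter fun q => eQ.symm q ∈ F).toList.map fun q : Fin n => ((q : ℕ), 0)
  refine ⟨fun i => (n, m, (eQ q₀ : ℕ), 0, l.map fun t => f t i, l'), ?_, fun i => ?_⟩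
  · have hf : ∀ t, Computable (f t) := fun t =>
      (Computable.const _).pair (Computable.option_some.comp (hwt _ _ _))
    exact (Computable.const n).pair <| (Computable.const m).pair <|
      (Computable.const _).pair <| (Computable.const _).pair <|
      (computable_list_map_of_forall f l hf).pair (Computable.const l')
  · refine ⟨_, _, rfl, ?_, ?_⟩
    · ext x
      simp only [Set.mem_ofPred_eq, Set.mem_range, List.mem_map]
      constructor
      · rintro ⟨⟨p, a, q⟩, h, rfl⟩
        refine ⟨⟨(p, some a, q), a, rfl, ?_⟩, rfl⟩
        simpa [l] using h
      · rintro ⟨⟨⟨p, o, q⟩, a, ha, e⟩, rfl⟩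
        simp only at ha
        subst ha
        exact ⟨(p, a, q), by simpa [l] using e, rfl⟩
    · ext x
      simp only [Set.mem_ofPred_eq, Set.mem_range, l', List.mem_map]
      constructor
      · rintro ⟨q, h, rfl⟩
        exact ⟨⟨q, show eQ.symm q ∈ F by simpa using h⟩, rfl⟩
      · rintro ⟨⟨q, h : eQ.symm q ∈ F⟩, rfl⟩
        exact ⟨q, by simpa using h, rfl⟩

end WeightedAutomaton

/-! ### Counter systems and the checking automaton -/

open WeightedAutomaton

/-- A machine with control states `S` and registers `R` holding natural numbers. Along an edge
`s → t` the old and the new value of every register are related by a linear equation. -/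
structure CounterSystem (S R : Type) where
  init : S
  Halting : S → Prop
  Edge : S → S → Prop
  oldCoeff : S → S → R → ℤ
  newCoeff : S → S → R → ℤ
  const : S → S → R → ℤ
  not_edge_init : ∀ s, ¬Edge s init

namespace CounterSystem

variable {S R : Type} (M : CounterSystem S R)

/-- The value of the linear equation for the register `r` along `s → t`. -/
def defect (s : S) (x : R → ℕ) (t : S) (y : R → ℕ) (r : R) : ℤ :=
  M.oldCoeff s t r * x r + M.newCoeff s t r * y r + M.const s t r

/-- The configurations that can be reached from the initial state with arbitrary registers. -/
inductive Reachable : S → (R → ℕ) → Prop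
  | init (x : R → ℕ) : Reachable M.init x
  | step {s t : S} {x y : R → ℕ} : Reachable s x → M.Edge s t → (∀ r, M.defect s x t y r = 0) →
      Reachable t y

/-- Some halting state can be reached. -/
def Halts : Prop := ∃ s x, M.Reachable s x ∧ M.Halting s

/-- The states of the automaton that looks for an error in a purported halting computation:
`idle s` has seen no error so far and reads the registers of a configuration with state `s`; the
states `old s t r σ` and `new s t r σ` read the registers of two consecutive configurations
and check the equation for `r` along `s → t`, up to the sign `σ`; `done` has found an error. -/
inductive Checker (S R : Type)
  | idle (s : S)
  | old (s t : S) (r : R) (σ : ℤˣ)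
  | new (s t : S) (r : R) (σ : ℤˣ)
  | done

open Checker

instance [Finite S] [Finite R] : Finite (Checker S R) := by
  refine Finite.of_surjective (α := S ⊕ (S × S × R × ℤˣ) ⊕ (S × S × R × ℤˣ) ⊕ Unit)
    (Sum.elim idle (Sum.elim (fun c => old c.1 c.2.1 c.2.2.1 c.2.2.2)
      (Sum.elim (fun c => new c.1 c.2.1 c.2.2.1 c.2.2.2) fun _ => done))) ?_
  rintro (s | ⟨s, t, r, σ⟩ | ⟨s, t, r, σ⟩ | _)
  · exact ⟨.inl s, rfl⟩
  · exact ⟨.inr (.inl (s, t, r, σ)), rfl⟩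
  · exact ⟨.inr (.inr (.inl (s, t, r, σ))), rfl⟩
  · exact ⟨.inr (.inr (.inr ())), rfl⟩

/-- The states in which the automaton can start to read the registers of a configuration that is
correct so far. -/
inductive Fresh : S → Checker S R → Prop
  | idle (s : S) : Fresh s (idle s)
  | old {s t : S} (r : R) (σ : ℤˣ) : M.Edge s t → Fresh s (old s t r σ)

/-- The states in which an error has been paid for. -/
inductive Finished : Checker S R → Prop
  | new (s t : S) (r : R) (σ : ℤˣ) : Finished (new s t r σ)
  | done : Finished done

/-- The transitions of the checking automaton. -/
inductive Trans : Checker S R → S ⊕ R → Checker S R → Prop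
  | loop (p : Checker S R) (r : R) : Trans p (.inr r) p
  | next {s t : S} {q : Checker S R} : M.Edge s t → M.Fresh t q → Trans (idle s) (.inl t) q
  | error {s t : S} : ¬M.Edge s t → ¬(M.Halting s ∧ t = M.init) → Trans (idle s) (.inl t) done
  | check (s t : S) (r : R) (σ : ℤˣ) : Trans (old s t r σ) (.inl t) (new s t r σ)
  | skip {p : Checker S R} {t : S} : Finished p → t ≠ M.init → Trans p (.inl t) done
  | restart {p q : Checker S R} : Finished p → M.Fresh M.init q → Trans p (.inl M.init) q

-- The transitions ignore the equations. Systems that differ only in coefficients thus give one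
-- automaton with varying weights.
variable {M} in
theorem trans_congr {M' : CounterSystem S R} (hi : M.init = M'.init) (he : M.Edge = M'.Edge)
    (hh : M.Halting = M'.Halting) : M.Trans = M'.Trans := by
  have key : ∀ {N N' : CounterSystem S R}, N.init = N'.init → N.Edge = N'.Edge →
      N.Halting = N'.Halting → ∀ p a q, N.Trans p a q → N'.Trans p a q := by
    intro N N' hi he hh p a q h
    have hf : ∀ {s q}, N.Fresh s q → N'.Fresh s q := by
      intro s q h
      cases h with
      | idle => exact .idle s
      | old r σ h => exact .old r σ (he ▸ h)
    cases h with
    | loop p r => exact .loop p r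
    | next h h' => exact .next (he ▸ h) (hf h')
    | error h h' => exact .error (he ▸ h) (hh ▸ hi ▸ h')
    | check s t r σ => exact .check s t r σ
    | skip h h' => exact .skip h (hi ▸ h')
    | restart h h' => rw [hi] at h' ⊢; exact .restart h (hf h')
  funext p a q
  exact propext ⟨key hi he hh p a q, key hi.symm he.symm hh.symm p a q⟩

/-- The states in which the checking automaton accepts. -/
def Accepting : Checker S R → Prop
  -- A correct halting computation at the end of the word must not be accepted for free.
  | idle s => ¬M.Halting s
  | old _ _ _ _ => False
  | new _ _ _ _ => True
  | done => True

open Classical in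
/-- The weight of reading a letter in a state of the checking automaton. -/
noncomputable def weight : Checker S R → S ⊕ R → ℤ
  | old s t r σ, .inr r' => if r' = r then σ * M.oldCoeff s t r else 0
  | old s t r σ, .inl _ => 1 + σ * M.const s t r
  | new s t r σ, .inr r' => if r' = r then σ * M.newCoeff s t r else 0
  | _, _ => 0

/-- The runs of the checking automaton. -/
abbrev CRuns : Checker S R → List (S ⊕ R) → Checker S R → ℤ → Prop :=
  Runs M.Trans fun p a _ => M.weight p a

open Classical in
/-- The weight of reading a list of registers in a state of the checking automaton. -/
noncomputable def blockWeight : Checker S R → List R → ℤ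
  | old s t r σ, u => σ * M.oldCoeff s t r * u.count r
  | new s t r σ, u => σ * M.newCoeff s t r * u.count r
  | _, _ => 0

theorem weight_inr_add_blockWeight (p : Checker S R) (r : R) (u : List R) :
    M.weight p (.inr r) + M.blockWeight p u = M.blockWeight p (r :: u) := by
  cases p <;> simp only [weight, blockWeight, List.count_cons, add_zero]
  all_goals split_ifs <;> simp_all
  all_goals ring

theorem cRuns_block (p : Checker S R) (u : List R) :
    M.CRuns p (u.map .inr) p (M.blockWeight p u) := by
  induction u with
  | nil =>
    have : M.blockWeight p [] = 0 := by cases p <;> simp [blockWeight]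
    rw [this]; exact .nil p
  | cons r u ih =>
    rw [← weight_inr_add_blockWeight]
    exact .cons (.loop p r) ih

theorem cRuns_block_iff {p q : Checker S R} {u : List R} {k : ℤ} :
    M.CRuns p (u.map .inr) q k ↔ q = p ∧ k = M.blockWeight p u := by
  refine ⟨fun h => ?_, ?_⟩
  · induction u generalizing k with
    | nil =>
      obtain ⟨rfl, rfl⟩ := runs_nil_iff.1 h
      exact ⟨rfl, by cases p <;> simp [blockWeight]⟩
    | cons r u ih =>
      obtain ⟨p', l, e, h', rfl⟩ := runs_cons_iff.1 h
      cases e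
      obtain ⟨rfl, rfl⟩ := ih h'
      exact ⟨rfl, M.weight_inr_add_blockWeight _ _ _⟩
  · rintro ⟨rfl, rfl⟩; exact M.cRuns_block _ _

/-- `w` is empty or begins with a control state. -/
def Boundary (w : List (S ⊕ R)) : Prop := ∀ r w', w ≠ .inr r :: w'

theorem exists_eq_block_append (w : List (S ⊕ R)) :
    ∃ (u : List R) (w' : List (S ⊕ R)), w = u.map .inr ++ w' ∧ Boundary w' := by
  induction w with
  | nil => exact ⟨[], [], rfl, by simp [Boundary]⟩
  | cons a w ih =>
    rcases a with s | r
    · exact ⟨[], _, rfl, by simp [Boundary]⟩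
    · obtain ⟨u, w', rfl, h⟩ := ih
      exact ⟨r :: u, w', rfl, h⟩

/-- There is an accepting run over `w` that starts in `p` and has weight at most `k`. -/
def Accepts (p : Checker S R) (w : List (S ⊕ R)) (k : ℤ) : Prop :=
  ∃ q, M.Accepting q ∧ ∃ l ≤ k, M.CRuns p w q l

/-! ### Without halting, every word is cheap -/

variable {M}

theorem Accepts.cons {p p' : Checker S R} {a : S ⊕ R} {w : List (S ⊕ R)} {k : ℤ}
    (e : M.Trans p a p') (h : M.Accepts p' w k) : M.Accepts p (a :: w) (M.weight p a + k) := by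
  obtain ⟨q, hq, l, hl, h⟩ := h
  exact ⟨q, hq, _, by gcongr, .cons e h⟩

theorem Accepts.block_append {p : Checker S R} {w : List (S ⊕ R)} {k : ℤ} (u : List R)
    (h : M.Accepts p w k) : M.Accepts p (u.map .inr ++ w) (M.blockWeight p u + k) := by
  obtain ⟨q, hq, l, hl, h⟩ := h
  exact ⟨q, hq, _, by gcongr, (M.cRuns_block p u).append h⟩

theorem Accepts.mono {p : Checker S R} {w : List (S ⊕ R)} {k l : ℤ} (h : M.Accepts p w k)
    (hkl : k ≤ l) : M.Accepts p w l := by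
  obtain ⟨q, hq, m, hm, h⟩ := h
  exact ⟨q, hq, m, hm.trans hkl, h⟩

theorem accepts_nil {p : Checker S R} (hp : M.Accepting p) : M.Accepts p [] 0 :=
  ⟨p, hp, 0, le_rfl, .nil p⟩

theorem Finished.accepting {p : Checker S R} (hp : Finished p) : M.Accepting p := by
  cases hp <;> trivial

theorem Finished.weight_inl {p : Checker S R} (hp : Finished p) (t : S) :
    M.weight p (.inl t) = 0 := by
  cases hp <;> rfl

/-- The sign opposite to that of `d` gives `1 - |d|`, and `|d| ≥ 1`. -/
theorem exists_unit_mul_lt {d : ℤ} (hd : d ≠ 0) : ∃ σ : ℤˣ, 1 + σ * d ≤ 0 := by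
  rcases lt_or_gt_of_ne hd with h | h
  · exact ⟨1, by simp; omega⟩
  · exact ⟨-1, by simp; omega⟩

-- Induction over the word, one configuration at a time. A run that has paid can go on at no cost.
-- At a correctly reached configuration the next one decides which fresh state to enter: `old` if
-- the edge is allowed but a register equation fails, `idle` otherwise. At the end of the word
-- `idle` accepts because no halting state is reachable.
open Classical in
theorem accepts_of_not_halts (hM : ¬M.Halts) (n : ℕ) (w : List (S ⊕ R)) (hn : w.length ≤ n)
    (hw : Boundary w) : (∀ p, Finished p → M.Accepts p w 0) ∧
      ∀ (s : S) (u : List R), M.Reachable s (fun r => u.count r) →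
        ∃ p, M.Fresh s p ∧ M.Accepts p (u.map .inr ++ w) 0 := by
  induction n generalizing w with
  | zero =>
    obtain rfl : w = [] := List.eq_nil_of_length_eq_zero (by omega)
    refine ⟨fun p hp => accepts_nil hp.accepting, fun s u hs => ⟨_, .idle s, ?_⟩⟩
    have h : M.Accepts (idle s) [] 0 := accepts_nil fun h => hM ⟨_, _, hs, h⟩
    exact h.block_append u
  | succ n ih =>
    rcases w with _ | ⟨s' | r, w'⟩
    · exact ih [] (Nat.zero_le _) hw
    · rename' s' => t
      obtain ⟨u', w, rfl, hw'⟩ := exists_eq_block_append w'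
      obtain ⟨ih₁, ih₂⟩ := ih w (by simp at hn; omega) hw'
      have hdone : M.Accepts done (u'.map .inr ++ w) 0 := (ih₁ done .done).block_append u'
      refine ⟨fun p hp => ?_, fun s u hs => ?_⟩
      · by_cases ht : t = M.init
        · subst ht
          obtain ⟨q, hq, h⟩ := ih₂ M.init u' (.init _)
          exact (h.cons (.restart hp hq)).mono (by rw [hp.weight_inl, add_zero])
        · exact (hdone.cons (.skip hp ht)).mono (by rw [hp.weight_inl, add_zero])
      · by_cases he : M.Edge s t
        · by_cases hd : ∀ r, M.defect s (fun r => u.count r) t (fun r => u'.count r) r = 0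
          · obtain ⟨q, hq, h⟩ := ih₂ t u' (hs.step he hd)
            refine ⟨idle s, .idle s, ?_⟩
            exact (h.cons (.next he hq)).block_append u
          · push Not at hd
            obtain ⟨r, hr⟩ := hd
            obtain ⟨σ, hσ⟩ := exists_unit_mul_lt hr
            refine ⟨old s t r σ, .old r σ he, ?_⟩
            have h := (((ih₁ _ (.new s t r σ)).block_append u').cons
              (.check s t r σ)).block_append u
            refine h.mono (le_trans (le_of_eq ?_) hσ)
            simp only [blockWeight, weight, defect]
            ring
        · refine ⟨idle s, .idle s, ?_⟩
          exact (hdone.cons (.error he fun h => hM ⟨_, _, hs, h.1⟩)).block_append u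
    · exact absurd rfl (hw _ _)

theorem accepts_done_of_not_halts (hM : ¬M.Halts) (w : List (S ⊕ R)) : M.Accepts done w 0 := by
  obtain ⟨u, w, rfl, hw⟩ := exists_eq_block_append w
  exact ((accepts_of_not_halts hM _ w le_rfl hw).1 done .done).block_append u

/-! ### With halting, repeated computations are expensive -/

variable (M)

open Classical in
/-- What is known about the weight `k` of a run that entered a correct computation with weight at
least `K`, and has reached the state `p` by reading it up to a configuration with state `s`
and registers `u`. -/
def Bound (K : ℤ) (s : S) (u : List R) : Checker S R → ℤ → Prop
  | idle s', k => s' = s ∧ K ≤ k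
  | old s' t r σ, k => s' = s ∧ M.Edge s t ∧ K + σ * M.oldCoeff s t r * u.count r ≤ k
  | new _ _ _ _, k => K + 1 ≤ k
  | done, k => K + 1 ≤ k

variable {M}

theorem Fresh.bound {K k : ℤ} {s : S} {p : Checker S R} (hp : M.Fresh s p) (hk : K ≤ k)
    (u : List R) : M.Bound K s u p (k + M.blockWeight p u) := by
  cases hp with
  | idle => exact ⟨rfl, by simpa [blockWeight] using hk⟩
  | old r σ he => exact ⟨rfl, he, by simpa [blockWeight] using hk⟩

-- Along a correct step no control error can be reported, and a register check adds up to `1 + σ *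
-- 0`, whichever register and sign were guessed.
open Classical in
theorem Bound.step {K k l : ℤ} {s t : S} {u u' : List R} {p q : Checker S R}
    (hp : M.Bound K s u p k) (he : M.Edge s t)
    (hd : ∀ r, M.defect s (fun r => u.count r) t (fun r => u'.count r) r = 0)
    (h : M.CRuns p (.inl t :: u'.map .inr) q l) : M.Bound K t u' q (k + l) := by
  have ht : t ≠ M.init := by rintro rfl; exact M.not_edge_init _ he
  obtain ⟨p', l, e, h', rfl⟩ := runs_cons_iff.1 h
  obtain ⟨rfl, rfl⟩ := M.cRuns_block_iff.1 h'
  cases e with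
  | next he' hq =>
    obtain ⟨rfl, hk⟩ := hp
    simpa [weight] using hq.bound hk u'
  | error he' => 
    obtain ⟨rfl, hk⟩ := hp
    exact absurd he he'
  | check s' t' r σ =>
    obtain ⟨rfl, -, hk⟩ := hp
    -- The weights of the two blocks and of the letter `t` sum to `1 + σ * defect`.
    have := congrArg ((σ : ℤ) * ·) (hd r)
    simp only [defect] at this
    simp only [Bound, weight, blockWeight]
    linarith
  | skip hp' =>
    rw [hp'.weight_inl]
    cases hp' <;> simpa [Bound, blockWeight] using hp
  | restart => exact absurd rfl ht

open Classical in
theorem exists_count_eq [Finite R] (x : R → ℕ) : ∃ u : List R, (fun r => u.count r) = x := by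
  refine ⟨(Finsupp.toMultiset (Finsupp.equivFunOnFinite.symm x)).toList, ?_⟩
  ext r
  rw [← Multiset.coe_count, Multiset.coe_toList, Finsupp.count_toMultiset]
  rfl

-- The word spells out the computation, with registers in unary. `Bound` must hold for all runs over
-- it, since the automaton may guess anything; `Bound.step` carries it along.
open Classical in
theorem Reachable.exists_word [Finite R] {s : S} {x : R → ℕ} (h : M.Reachable s x) :
    ∃ (w : List (S ⊕ R)) (u : List R), (fun r => u.count r) = x ∧
      ∀ K p k q l, Finished p → K ≤ k → M.CRuns p (.inl M.init :: w) q l →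
        M.Bound K s u q (k + l) := by
  induction h with
  | init x =>
    obtain ⟨u, hu⟩ := exists_count_eq x
    refine ⟨u.map .inr, u, hu, fun K p k q l hp hk h => ?_⟩
    obtain ⟨p', l, e, h', rfl⟩ := runs_cons_iff.1 h
    obtain ⟨rfl, rfl⟩ := M.cRuns_block_iff.1 h'
    rw [hp.weight_inl, zero_add]
    refine Fresh.bound ?_ hk u
    generalize ht : M.init = t at e
    cases e with
    | restart _ hq => rwa [← ht] at hq ⊢
    | skip _ hne => exact absurd ht.symm hne
    | _ => cases hp
  | @step s t x y _ he hd ih =>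
    obtain ⟨w, u, rfl, ih⟩ := ih
    obtain ⟨u', rfl⟩ := exists_count_eq y
    refine ⟨w ++ .inl t :: u'.map .inr, u', rfl, fun K p k q l hp hk h => ?_⟩
    rw [← List.cons_append] at h
    obtain ⟨r, l, m, h₁, h₂, rfl⟩ := runs_append_iff.1 h
    rw [← add_assoc]
    exact (ih K p k r l hp hk h₁).step he hd h₂

/-- Each copy starts and ends in a finished state and contributes at least `1`. -/
theorem exists_word_of_halts [Finite R] (hM : M.Halts) : ∃ w : List (S ⊕ R),
    ∀ (n : ℕ) (p q : Checker S R) (l : ℤ), Finished p → M.Accepting q →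
      M.CRuns p (List.replicate n (.inl M.init :: w)).flatten q l → n ≤ l := by
  obtain ⟨s, x, h, hs⟩ := hM
  obtain ⟨w, u, -, hw⟩ := h.exists_word
  refine ⟨w, fun n => ?_⟩
  induction n with
  | zero =>
    intro p q l hp hq h
    exact (runs_nil_iff.1 h).2.ge
  | succ n ih =>
    intro p q l hp hq h
    rw [List.replicate_succ, List.flatten_cons] at h
    obtain ⟨r, l, m, h₁, h₂, rfl⟩ := runs_append_iff.1 h
    have hb := hw 0 p 0 r l hp le_rfl h₁
    -- A run that has not paid is stuck at the halting configuration: `idle` neither accepts there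
    -- nor can read `M.init`, and `old` does not accept and would need an edge into `M.init`.
    have hr : Finished r := by
      by_contra hr
      rcases n with _ | n
      · obtain ⟨rfl, -⟩ := runs_nil_iff.1 h₂
        cases r with
        | idle s' => obtain ⟨rfl, -⟩ := hb; exact hq hs
        | old => exact hq
        | new => exact hr (.new _ _ _ _)
        | done => exact hr .done
      · rw [List.replicate_succ, List.flatten_cons, List.cons_append] at h₂
        obtain ⟨r', m, e, -, rfl⟩ := runs_cons_iff.1 h₂
        generalize ht : M.init = t at e
        cases e with
        | next he => subst ht; exact M.not_edge_init _ he
        | error _ hne => obtain ⟨rfl, -⟩ := hb; exact hne ⟨hs, ht.symm⟩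
        | check => subst ht; exact M.not_edge_init _ hb.2.1
        | skip hr' => exact hr hr'
        | restart hr' => exact hr hr'
    have hl : 1 ≤ l := by cases hr <;> simpa [Bound] using hb
    have := ih r q m hr hq h₂
    push_cast
    linarith

/-- The weights computed by the checking automaton are bounded iff the machine does not halt. -/
theorem exists_bound_iff_not_halts [Finite R] :
    (∃ c : ℤ, ∀ w, ∃ q, M.Accepting q ∧ ∃ k ≤ c, M.CRuns done w q k) ↔ ¬M.Halts := by
  refine ⟨?_, fun hM => ⟨0, fun w => accepts_done_of_not_halts hM w⟩⟩
  rintro ⟨c, hc⟩ hM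
  obtain ⟨w, hw⟩ := exists_word_of_halts hM
  obtain ⟨q, hq, k, hk, h⟩ := hc (List.replicate (c.toNat + 1) (.inl M.init :: w)).flatten
  have := hw _ _ _ _ .done hq h
  omega

end CounterSystem

/-! ### Half tapes as numbers -/

namespace Turing

section Tape

variable {Γ : Type} [Inhabited Γ] [Finite Γ]

open Classical in
/-- A numbering of the tape symbols that gives the blank the number `0`. -/
noncomputable def symbolCode (a : Γ) : ℕ := if a = default then 0 else Finite.equivFin Γ a + 1

variable (Γ) in
/-- The base in which half tapes are written as numbers. -/
noncomputable def tapeBase : ℕ := Nat.card Γ + 1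

theorem symbolCode_lt (a : Γ) : symbolCode a < tapeBase Γ := by
  unfold symbolCode tapeBase
  split_ifs <;> omega

theorem symbolCode_injective : Function.Injective (symbolCode (Γ := Γ)) := by
  intro a b h
  unfold symbolCode at h
  split_ifs at h with ha hb hb
  · rw [ha, hb]
  · exact (Finite.equivFin Γ).injective (Fin.ext (Nat.succ_injective h))

/-- The number that has a half tape as its digits, the least significant digit first. -/
noncomputable def ListBlank.toNat (l : ListBlank Γ) : ℕ :=
  l.liftOn (List.foldr (fun a n => symbolCode a + tapeBase Γ * n) 0) <| by
    rintro a _ ⟨n, rfl⟩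
    rw [List.foldr_append]
    -- Trailing blanks do not change the number, because the blank has the code `0`.
    congr 1
    induction n with
    | zero => rfl
    | succ n ih => rw [List.replicate_succ, List.foldr_cons, ← ih]; simp [symbolCode]

theorem ListBlank.toNat_mk (l : List Γ) : (ListBlank.mk l).toNat =
    l.foldr (fun a n => symbolCode a + tapeBase Γ * n) 0 := rfl

theorem ListBlank.toNat_cons (a : Γ) (l : ListBlank Γ) :
    (l.cons a).toNat = symbolCode a + tapeBase Γ * l.toNat :=
  l.induction_on fun l => by rw [ListBlank.cons_mk, toNat_mk, toNat_mk, List.foldr_cons]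

theorem ListBlank.toNat_eq (l : ListBlank Γ) :
    l.toNat = symbolCode l.head + tapeBase Γ * l.tail.toNat := by
  rw [← ListBlank.toNat_cons, ListBlank.cons_head_tail]

/-- Codes are smaller than the base, so last digit and quotient are unique. -/
theorem eq_of_symbolCode_add_eq {a b : Γ} {x y : ℕ}
    (h : symbolCode a + tapeBase Γ * x = symbolCode b + tapeBase Γ * y) : a = b ∧ x = y := by
  have ha := symbolCode_lt a
  have hb := symbolCode_lt b
  have hab := congrArg (· % tapeBase Γ) h
  simp only [Nat.add_mul_mod_self_left, Nat.mod_eq_of_lt ha, Nat.mod_eq_of_lt hb] at hab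
  rw [hab] at h
  exact ⟨symbolCode_injective hab, Nat.eq_of_mul_eq_mul_left (by omega) (Nat.add_left_cancel h)⟩

/-- The two half tapes as numbers. -/
noncomputable def Tape.toRegisters (T : Tape Γ) : Dir → ℕ
  | .left => T.left.toNat
  | .right => T.right.toNat

end Tape

instance : Finite Dir :=
  Finite.of_surjective (α := Bool) (fun b => bif b then .right else .left)
    fun d => by cases d <;> simp

/-! ### Turing machines as counter systems -/

namespace TM0

variable {Γ Λ : Type} [Inhabited Γ] [Finite Γ] [Inhabited Λ]

open Classical in
/-- The coefficients of the old value and the new value of a register, and the constant term, in the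
equation that describes a step of a Turing machine. -/
noncomputable def registerEq (M : Machine Γ Λ) (S : Set Λ) (N : ℕ) :
    Option (S × Γ) → Option (S × Γ) → Dir → ℤ × ℤ × ℤ
  | some (q, a), some (_, a'), d =>
    match M q a with
    | some (_, .move d') =>
      -- The half tape on the side of the move loses the new head symbol: `old = symbolCode a' +
      -- tapeBase Γ * new`. The other one gains the old head symbol: `new = symbolCode a + tapeBase
      -- Γ * old`.
      if d = d' then (-1, tapeBase Γ, symbolCode a') else (-tapeBase Γ, 1, -symbolCode a)
    | _ => (-1, 1, 0)
  | _, _, .left => (0, 1, 0)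
  | _, _, .right => (0, 1, -N)

/-- The control states of a Turing machine, together with the symbol under the head, and the numbers
of its two half tapes form a system with two registers. The computation begins with head symbol `h`,
blank left half tape, and right half tape with number `N`. -/
noncomputable def toCounterSystem (M : Machine Γ Λ) (S : Set Λ) (h : Γ) (N : ℕ) :
    CounterSystem (Option (S × Γ)) Dir where
  init := none
  Halting s := ∃ p, s = some p ∧ M p.1 p.2 = none
  Edge
    | none, some (q, a) => (q : Λ) = default ∧ a = h
    | some (q, a), some (q', a') => ∃ st, M q a = some ((q' : Λ), st) ∧ ∀ c, st = .write c → a' = c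
    | _, none => False
  oldCoeff s t d := (registerEq M S N s t d).1
  newCoeff s t d := (registerEq M S N s t d).2.1
  const s t d := (registerEq M S N s t d).2.2
  not_edge_init s := by rcases s with _ | ⟨q, a⟩ <;> exact id

variable {M : Machine Γ Λ} {S : Set Λ}

theorem reachable_of_reaches (ss : Supports M S) {h : Γ} {N : ℕ} {l : List Γ} (hh : l.headI = h)
    (hN : (ListBlank.mk l.tail).toNat = N) {c : Cfg Γ Λ} (hc : Reaches M (init l) c) :
    ∃ hq : c.q ∈ S, (toCounterSystem M S h N).Reachable (some (⟨c.q, hq⟩, c.Tape.head))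
      c.Tape.toRegisters := by
  induction hc with
  | refl =>
    -- The starting registers do not matter, as the initial edge has old coefficients `0`.
    refine ⟨ss.1, (CounterSystem.Reachable.init (M := toCounterSystem M S h N) 0).step ⟨rfl, hh⟩ ?_⟩
    have hl : (ListBlank.mk ([] : List Γ)).toNat = 0 := rfl
    rintro (_ | _)
    · simpa [CounterSystem.defect, toCounterSystem, registerEq, init, Tape.mk₁, Tape.mk₂, Tape.mk',
        Tape.toRegisters] using hl
    · simp [CounterSystem.defect, toCounterSystem, registerEq, init, Tape.mk₁, Tape.mk₂, Tape.mk',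
        Tape.toRegisters, hN]
  | @tail c c' _ hs ih =>
    obtain ⟨hq, ih⟩ := ih
    refine ⟨step_supports M ss hs hq, ?_⟩
    obtain ⟨q, ⟨a, L, R⟩⟩ := c
    obtain ⟨⟨q', st⟩, hM, rfl⟩ := Option.map_eq_some_iff.1 hs
    refine ih.step (t := some _) ⟨st, hM, ?_⟩ fun d => ?_
    · rintro c rfl; rfl
    · simp only [CounterSystem.defect, toCounterSystem, registerEq] at hM ⊢
      rw [hM]
      have hL := L.toNat_eq
      have hR := R.toNat_eq
      rcases st with (_ | _) | c <;> rcases d with _ | _ <;>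
        simp [Tape.move, Tape.write, Tape.toRegisters, ListBlank.toNat_cons] <;>
        first | (rw [hL]; push_cast; ring) | (rw [hR]; push_cast; ring)

/-- On a move the edge leaves the new head symbol free. The register equation forces it to be the
last digit of the half tape on that side. -/
theorem exists_reaches_of_reachable {h : Γ} {N : ℕ} {l : List Γ} (hh : l.headI = h)
    (hN : (ListBlank.mk l.tail).toNat = N) {s : Option (S × Γ)} {x : Dir → ℕ}
    (hs : (toCounterSystem M S h N).Reachable s x) : s = none ∨
      ∃ (c : Cfg Γ Λ) (hq : c.q ∈ S), Reaches M (init l) c ∧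
        s = some (⟨c.q, hq⟩, c.Tape.head) ∧ x = c.Tape.toRegisters := by
  induction hs with
  | init x => exact .inl rfl
  | @step s t x y _ he hd ih =>
    right
    rcases t with _ | ⟨⟨q', hq'⟩, a'⟩
    · exact absurd he ((toCounterSystem M S h N).not_edge_init s)
    rcases ih with rfl | ⟨⟨q, ⟨a, L, R⟩⟩, hq, hc, rfl, rfl⟩
    · obtain ⟨h₁, h₂⟩ := he
      simp only at h₁
      subst h₁ h₂
      refine ⟨init l, hq', .refl, ?_, ?_⟩
      · rw [← hh]; rfl
      · have hl : (ListBlank.mk ([] : List Γ)).toNat = 0 := rfl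
        ext d
        have := hd d
        rcases d with _ | _ <;>
          simp [CounterSystem.defect, toCounterSystem, registerEq, init, Tape.mk₁, Tape.mk₂,
            Tape.mk', Tape.toRegisters] at this ⊢ <;> omega
    · obtain ⟨st, hM, hw⟩ := he
      simp only at hM
      have hL := L.toNat_eq
      have hR := R.toNat_eq
      have hl := hd .left
      have hr := hd .right
      rcases st with (_ | _) | c <;>
        simp only [CounterSystem.defect, toCounterSystem, registerEq, hM, Tape.toRegisters, if_true,
          reduceCtorEq, if_false] at hl hr
      · obtain ⟨h₁, h₂⟩ := eq_of_symbolCode_add_eq (hL.symm.trans (show _ = symbolCode a' +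
          tapeBase Γ * y .left by zify; linarith))
        refine ⟨⟨q', Tape.move .left ⟨a, L, R⟩⟩, hq', hc.tail (by simp only [step, hM]; rfl),
          by rw [← h₁]; rfl, ?_⟩
        ext d
        rcases d with _ | _
        · exact h₂.symm
        · simp only [Tape.move, Tape.toRegisters, ListBlank.toNat_cons]
          zify; linarith
      · obtain ⟨h₁, h₂⟩ := eq_of_symbolCode_add_eq (hR.symm.trans (show _ = symbolCode a' +
          tapeBase Γ * y .right by zify; linarith))
        refine ⟨⟨q', Tape.move .right ⟨a, L, R⟩⟩, hq', hc.tail (by simp only [step, hM]; rfl),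
          by rw [← h₁]; rfl, ?_⟩
        ext d
        rcases d with _ | _
        · simp only [Tape.move, Tape.toRegisters, ListBlank.toNat_cons]
          zify; linarith
        · exact h₂.symm
      · refine ⟨⟨q', Tape.write c ⟨a, L, R⟩⟩, hq', hc.tail (by simp only [step, hM]; rfl),
          by rw [hw c rfl]; rfl, ?_⟩
        ext d
        rcases d with _ | _ <;> simp only [Tape.write, Tape.toRegisters] <;> omega

/-- The counter system of a Turing machine halts iff the Turing machine does. -/
theorem halts_toCounterSystem_iff (ss : Supports M S) {h : Γ} {N : ℕ} {l : List Γ}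
    (hh : l.headI = h) (hN : (ListBlank.mk l.tail).toNat = N) :
    (toCounterSystem M S h N).Halts ↔ (eval M l).Dom := by
  have heval : (eval M l).Dom ↔ ∃ c, Reaches M (init l) c ∧ step M c = none := by
    rw [eval, Part.dom_iff_mem]
    constructor
    · rintro ⟨_, h⟩
      obtain ⟨c, hc, -⟩ := (Part.mem_map_iff _).1 h
      exact ⟨c, StateTransition.mem_eval.1 hc⟩
    · rintro ⟨c, hc⟩
      exact ⟨_, Part.mem_map _ (StateTransition.mem_eval.2 hc)⟩
  rw [heval]
  constructor
  · rintro ⟨_, x, hs, p, rfl, hp⟩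
    obtain h | ⟨c, hq, hc, h, -⟩ := exists_reaches_of_reachable hh hN hs
    · cases h
    · cases h
      exact ⟨c, hc, by simp only at hp; simp only [step, hp]; rfl⟩
  · rintro ⟨c, hc, hn⟩
    obtain ⟨hq, hr⟩ := reachable_of_reaches ss hh hN hc
    refine ⟨_, _, hr, _, rfl, ?_⟩
    simpa [step] using hn

end TM0

end Turing

/-! ### Primitive recursive integer functions -/

theorem Primrec.int_ofNat : Primrec Int.ofNat :=
  Primrec.encode_iff.1 ((Primrec.nat_mul.comp (Primrec.const 2) Primrec.id).of_eq fun _ => rfl)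

theorem Primrec.int_negSucc : Primrec Int.negSucc :=
  Primrec.encode_iff.1 ((Primrec.nat_add.comp
    (Primrec.nat_mul.comp (Primrec.const 2) Primrec.id) (Primrec.const 1)).of_eq fun _ => rfl)

theorem Primrec.one_add_unit_mul_neg (σ : ℤˣ) : Primrec fun n : ℕ => 1 + (σ : ℤ) * -(n : ℤ) := by
  rcases Int.units_eq_one_or σ with rfl | rfl
  -- `1 - n` is `Int.ofNat (1 - n)` for `n ≤ 1` and `Int.negSucc (n - 2)` for `n ≥ 2`.
  · refine (Primrec.ite (Primrec.nat_le.comp Primrec.id (Primrec.const 1))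
      (Primrec.int_ofNat.comp (Primrec.nat_sub.comp (Primrec.const 1) Primrec.id))
      (Primrec.int_negSucc.comp (Primrec.nat_sub.comp Primrec.id (Primrec.const 2)))).of_eq
      fun n => ?_
    simp only [id]
    split_ifs with h
    · simp only [Int.ofNat_eq_natCast, Units.val_one]; omega
    · simp only [Int.negSucc_eq, Units.val_one]; omega
  · refine (Primrec.int_ofNat.comp Primrec.succ).of_eq fun n => ?_
    simp; ring

/-! ### A fixed machine with undecidable halting -/

namespace Turing

/-- The code recovers `m` from `2 ^ m - 1` by search and runs the `m`-th program on `0`. This input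
is used because its binary digits are `m` ones: the initial tape repeats one symbol, and its number
is easy to compute. -/
theorem exists_code_not_computablePred :
    ∃ c : ToPartrec.Code, ¬ComputablePred fun m : ℕ => (c.eval [2 ^ m - 1]).Dom := by
  let h : ℕ →. ℕ := fun m => (Denumerable.ofNat Nat.Partrec.Code m).eval 0
  have hh : Partrec h := Nat.Partrec.Code.eval_part.comp (Computable.ofNat _) (Computable.const 0)
  let f : ℕ →. ℕ := fun x => (Nat.rfind fun m => Part.some (decide (2 ^ m = x + 1))).bind h
  have hpow : Primrec fun m : ℕ => 2 ^ m :=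
    (Primrec.nat_rec₁ 1 (Primrec.nat_mul.comp (Primrec.const 2) Primrec.snd).to₂).of_eq fun m => by
      induction m with
      | zero => rfl
      | succ m ih => simp only [ih, pow_succ']
  have hf : Partrec f := by
    refine Partrec.bind (Partrec.rfind ?_) (hh.comp Computable.snd)
    refine Computable.partrec (Primrec.to_comp ?_)
    exact PrimrecPred.decide (Primrec.eq.comp (hpow.comp Primrec.snd)
      (Primrec.succ.comp Primrec.fst))
  obtain ⟨c, hc⟩ := ToPartrec.Code.exists_code (Nat.Partrec'.part_iff₁.2 hf)
  refine ⟨c, fun hd => ComputablePred.halting_problem 0 ?_⟩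
  have hdom : ∀ m, (c.eval [2 ^ m - 1]).Dom ↔ (h m).Dom := by
    intro m
    have hm : m ∈ Nat.rfind fun k => Part.some (decide (2 ^ k = 2 ^ m - 1 + 1)) := by
      rw [Nat.sub_add_cancel Nat.one_le_two_pow]
      refine Nat.mem_rfind.2 ⟨by simp, fun {k} hk => ?_⟩
      simpa using hk.ne
    have e : c.eval [2 ^ m - 1] = pure <$> f (2 ^ m - 1) :=
      hc ((2 ^ m - 1) ::ᵥ List.Vector.nil)
    simp only [f] at e
    rw [Part.eq_some_iff.2 hm, Part.bind_some] at e
    exact iff_of_eq (congrArg Part.Dom e)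
  refine (ComputablePred.computable_iff.2 ?_ : ComputablePred fun c : Nat.Partrec.Code => (c.eval 0).Dom)
  obtain ⟨g, hg, hg'⟩ := ComputablePred.computable_iff.1 hd
  refine ⟨fun c => g (Encodable.encode c), hg.comp Computable.encode, ?_⟩
  ext c
  have := congrFun hg' (Encodable.encode c)
  simp only [hdom, h, Denumerable.ofNat_encode] at this
  exact iff_of_eq this

open PartrecToTM2 in
theorem PartrecToTM2.trNat_two_pow_sub_one (m : ℕ) :
    trNat (2 ^ m - 1) = List.replicate m Γ'.bit1 := by
  induction m with
  | zero => simp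
  | succ m ih =>
    have e : ((2 ^ (m + 1) - 1 : ℕ) : Num) = ((2 ^ m - 1 : ℕ) : Num).bit1 := by
      rw [← Num.to_nat_inj]
      have := Nat.one_le_two_pow (n := m)
      simp only [Num.to_of_nat, Num.cast_bit1]
      omega
    rw [List.replicate_succ, ← ih, trNat, trNat, e]
    cases ((2 ^ m - 1 : ℕ) : Num) <;> rfl

instance : Finite PartrecToTM2.K' :=
  Finite.of_surjective (α := Bool × Bool)
    (fun b => match b with
      | (true, true) => .main
      | (true, false) => .rev
      | (false, true) => .aux
      | (false, false) => .stack)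
    fun k => by cases k <;> simp

open PartrecToTM2 in
/-- A code is run by a Turing machine with finitely many states, whose input is `2 ^ m - 1` is written with `m` equal
symbols. -/
theorem exists_machine (c : ToPartrec.Code) :
    ∃ (Γ Λ : Type) (_ : Inhabited Γ) (_ : Finite Γ) (_ : Inhabited Λ) (M : TM0.Machine Γ Λ)
      (S : Set Λ) (h a : Γ), S.Finite ∧ TM0.Supports M S ∧
      ∀ m, (TM0.eval M (h :: List.replicate m a)).Dom ↔ (c.eval [2 ^ m - 1]).Dom := by
  -- The default label is the start label, so this instance makes the machine start with `c`.
  let _ : Inhabited Λ' := ⟨trNormal c Cont'.halt⟩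
  let _ : Fintype K' := Fintype.ofFinite _
  let M₁ := TM2to1.tr tr
  have hs := TM1to0.tr_supports M₁ (TM2to1.tr_supports tr (tr_supports c Cont'.halt))
  -- The flag `true` marks the bottom of the stacks; only the main stack is filled initially.
  let cell (b : Bool) (a : Γ') : TM2to1.Γ' K' fun _ => Γ' :=
    (b, Function.update (fun _ => none) K'.main (some a))
  refine ⟨TM2to1.Γ' K' fun _ => Γ', TM1to0.Λ' M₁, inferInstance, inferInstance, inferInstance,
    TM1to0.tr M₁, _, cell true Γ'.cons, cell false Γ'.bit1, Finset.finite_toSet _, hs, fun m => ?_⟩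
  have hi : TM2to1.trInit (Γ := fun _ => Γ') K'.main (trList [2 ^ m - 1]) =
      cell true Γ'.cons :: List.replicate m (cell false Γ'.bit1) := by
    have e : (trList [2 ^ m - 1]).reverse = Γ'.cons :: List.replicate m Γ'.bit1 := by
      simp [trList, trNat_two_pow_sub_one]
    unfold TM2to1.trInit
    rw [e]
    exact congrArg (List.cons _) List.map_replicate
  have h2 : TM2.init K'.main (trList [2 ^ m - 1]) = init c [2 ^ m - 1] := by
    unfold TM2.init init
    congr 1
    funext k
    cases k <;> rfl
  rw [← hi, TM1to0.tr_eval]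
  refine (TM2to1.tr_eval_dom tr K'.main _).trans ?_
  have := congrArg Part.Dom (tr_eval c [2 ^ m - 1])
  rw [← h2] at this
  exact iff_of_eq this

theorem ListBlank.primrec_toNat_replicate {Γ : Type} [Inhabited Γ] [Finite Γ] (a : Γ) :
    Primrec fun m => (ListBlank.mk (List.replicate m a)).toNat :=
  (Primrec.nat_rec₁ 0 (Primrec.nat_add.comp (Primrec.const (symbolCode a))
    (Primrec.nat_mul.comp (Primrec.const (tapeBase Γ)) Primrec.snd)).to₂).of_eq fun m => by
      induction m with
      | zero => rfl
      | succ m ih => rw [List.replicate_succ, ← ListBlank.cons_mk, toNat_cons, ← ih]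

/-- Only the constant `-N` of the right half tape on an initial edge varies, and it enters only as
`1 + σ * -N`; every other weight is constant in `m`. -/
theorem TM0.computable_weight_toCounterSystem {Γ Λ : Type} [Inhabited Γ] [Finite Γ] [Inhabited Λ]
    (M : TM0.Machine Γ Λ) (S : Set Λ) (h : Γ) {N : ℕ → ℕ} (hN : Computable N)
    (p : CounterSystem.Checker (Option (S × Γ)) Dir) (a : Option (S × Γ) ⊕ Dir) :
    Computable fun m => (TM0.toCounterSystem M S h (N m)).weight p a := by
  have hold : ∀ N s t d, (registerEq M S N s t d).1 = (registerEq M S 0 s t d).1 := by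
    rintro N (_ | s) (_ | t) (_ | _) <;> rfl
  have hnew : ∀ N s t d, (registerEq M S N s t d).2.1 = (registerEq M S 0 s t d).2.1 := by
    rintro N (_ | s) (_ | t) (_ | _) <;> rfl
  have hconst : ∀ s t d, (∀ N, (registerEq M S N s t d).2.2 = (registerEq M S 0 s t d).2.2) ∨
      ∀ N : ℕ, (registerEq M S N s t d).2.2 = -N := by
    rintro (_ | s) (_ | t) (_ | _)
    all_goals first | exact .inl fun _ => rfl | exact .inr fun _ => rfl
  rcases p with s | ⟨s, t, r, σ⟩ | ⟨s, t, r, σ⟩ | _ <;> rcases a with b | d <;>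
    simp only [CounterSystem.weight, toCounterSystem, hold (N _), hnew (N _)]
  case old.inl =>
    rcases hconst s t r with h | h
    · simp only [h (N _)]
      exact Computable.const _
    · simp only [h (N _)]
      exact (Primrec.one_add_unit_mul_neg σ).to_comp.comp hN
  all_goals exact Computable.const _

end Turing

/-! ### The reduction -/

open Turing in
/-- Upper-boundedness of weighted automata over `(ℤ ∪ {∞}, min, +)` is undecidable: no algorithm
gives the right answer on all descriptions of all weighted automata whose weights are well
defined. -/
theorem mainTheorem4 :
    ¬ ∃ f : WACode → Bool, Computable f ∧
      ∀ (n m : ℕ) (W : WeightedAutomaton (Fin m) (Fin n)) (d : WACode),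
        W.HasMinima → W.IsDescribedBy d → (f d = true ↔ W.UpperBounded) := by
  rintro ⟨f, hf, hW⟩
  obtain ⟨c, hc⟩ := exists_code_not_computablePred
  obtain ⟨Γ, Λ, _, _, _, M, S, h, a, hS, ss, hM⟩ := exists_machine c
  have : Finite S := hS
  let N : ℕ → ℕ := fun m => (ListBlank.mk (List.replicate m a)).toNat
  have hN : Computable N := (ListBlank.primrec_toNat_replicate a).to_comp
  let C : ℕ → CounterSystem (Option (S × Γ)) Dir := fun m => TM0.toCounterSystem M S h (N m)
  let eQ := Finite.equivFin (CounterSystem.Checker (Option (S × Γ)) Dir)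
  let eA := Finite.equivFin (Option (S × Γ) ⊕ Dir)
  -- `exists_computable_description` needs one transition relation for all `m`.
  have hT : ∀ m, (C m).Trans = (C 0).Trans :=
    fun m => CounterSystem.trans_congr rfl rfl rfl
  obtain ⟨d, hd, hd'⟩ := exists_computable_description eQ eA (C 0).Trans
    (fun m p a _ => (C m).weight p a)
    (fun p a _ => TM0.computable_weight_toCounterSystem M S h hN p a) .done {q | (C 0).Accepting q}
  refine hc (ComputablePred.computable_iff.2 ⟨fun m => !f (d m),
    Primrec.not.to_comp.comp (hf.comp hd), ?_⟩)
  ext m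
  have h₁ : f (d m) = true ↔ (finEdges eQ eA (C 0).Trans (fun p a _ => (C m).weight p a) .done
      {q | (C 0).Accepting q}).UpperBounded := hW _ _ _ _ (hasMinima_ofEdges _ _) (hd' m)
  have h₂ : (∃ c : ℤ, ∀ w, ∃ q, (C 0).Accepting q ∧ ∃ k ≤ c,
    Runs (C 0).Trans (fun p a _ => (C m).weight p a) .done w q k) ↔ ¬(C m).Halts := by
    rw [← CounterSystem.exists_bound_iff_not_halts, ← hT m]
    rfl
  have h₃ := TM0.halts_toCounterSystem_iff ss (l := h :: List.replicate m a) rfl (N := N m) rfl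
  rw [← hM m, ← h₃, Bool.not_eq_true', ← Bool.not_eq_true, h₁, upperBounded_finEdges_iff]
  exact iff_not_comm.1 h₂
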